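/- All graphs are finite, simple and undirected. A graph $G$ is \emph{Hamiltonian} if it has a cycle containing every vertex of $G$. For $S\subseteq V(G)$, let $c(G-S)$ be the number of connected components of the graph $G-S$ obtained by deleting the vertices of $S$; $G$ is \emph{$1$-tough} if $|S|\ge c(G-S)$ for every $S\subseteq V(G)$ with $c(G-S)\ge 2$. For a positive integer $m$, a connected graph $G$ is \emph{$m$-connected} if deleting any set of at most $m-1$ vertices leaves a connected graph (the graph with no vertices is not connected). The graph $P_2\cup kP_1$ is the disjoint union of one edge and $k$ isolated vertices, and $G$ is \emph{$(P_2\cup kP_1)$-free} if it has no induced subgraph isomorphic to $P_2\cup kP_1$. \textbf{Theorem.} Let $k\ge 3$ be an integer. Every $1$-tough, $(2k-2)$-connected, $(P_2\cup kP_1)$-free graph is Hamiltonian. -/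

import Mathlib

namespace SimpleGraph

/-- The number `c(G - S)` of connected components of the graph obtained from `G` by
deleting the vertices in `S`. -/
noncomputable def numComponentsDelete {V : Type*} (G : SimpleGraph V) (S : Finset V) : ℕ :=
  Nat.card (G.induce ((S : Set V)ᶜ)).ConnectedComponent

/-- `G` is `t`-tough: `|S| ≥ t * c(G - S)` for every vertex set `S` with `c(G - S) ≥ 2`.
A complete graph has no such `S`, so it is `t`-tough for every `t`. -/
def IsTough {V : Type*} (G : SimpleGraph V) (t : ℝ) : Prop :=
  ∀ S : Finset V, 2 ≤ G.numComponentsDelete S →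
    t * (G.numComponentsDelete S : ℝ) ≤ (S.card : ℝ)

/-- `G` is `k`-connected: `G` is connected, and it stays connected after the deletion of any
at most `k - 1` vertices. (A connected graph is nonempty, so a `k`-connected graph has at least
`k` vertices.) -/
def IsKConnected {V : Type*} (G : SimpleGraph V) (k : ℕ) : Prop :=
  G.Connected ∧ ∀ S : Finset V, S.card < k → (G.induce ((S : Set V)ᶜ)).Connected

/-- The linear forest `P₂ ∪ kP₁`: the disjoint union of a path on two vertices and
`k` isolated vertices. -/
def pathTwoUnionIsolated (k : ℕ) : SimpleGraph (Fin 2 ⊕ Fin k) :=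
  pathGraph 2 ⊕g (⊥ : SimpleGraph (Fin k))

/-- `G` is `H`-free: `G` does not contain `H` as an induced subgraph. -/
def IsInducedFree {V W : Type*} (G : SimpleGraph V) (H : SimpleGraph W) : Prop :=
  ¬ H.IsIndContained G

end SimpleGraph

/-! Take a longest cycle C and suppose that a vertex h lies off it. For a component D of G − C,
rerouting C shows that the successors on C of the attachments of D are independent and have no
neighbour in D. Connectivity gives at least 2k − 2 ≥ k of them, so an edge inside D would produce an
induced P₂ ∪ kP₁ (`not_adj_of_off`). Hence h has d ≥ 2k − 2 neighbours, all on C. Let A consist of h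
and the d successors of these neighbours; A is independent.

Call a vertex heavy if it has a neighbour in A. By freeness a heavy vertex sees at least d + 2 − k
vertices of A, and every edge has a heavy end. All heavy vertices lie on C. If no two of them are
consecutive, deleting the set S of heavy vertices leaves an edgeless graph containing h and the |S|
successors of S, against toughness (`not_isTough`).

Suppose two consecutive vertices of C are heavy. Their neighbourhoods in A cannot cross, and d ≥ 2k
− 2 makes the resulting count tight (`structure_of_adj_adj`): the pair ends a segment between
consecutive neighbours of h, and certain chords are forced. Reversing C passes this property on to
the preceding segments, and the chords of a few successive segments reroute C through h
(`not_heavySegment`). -/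

namespace SimpleGraph

/-! ### Cycles as lists and as periodic sequences -/

/-- The increasing list of the integers in `[s, e]`. -/
def intSeg (s e : ℤ) : List ℤ := (List.range (e + 1 - s).toNat).map fun i : ℕ => s + i

@[simp] lemma mem_intSeg {s e x : ℤ} : x ∈ intSeg s e ↔ s ≤ x ∧ x ≤ e := by
  simp only [intSeg, List.mem_map, List.mem_range]
  constructor
  · rintro ⟨i, hi, rfl⟩; omega
  · rintro ⟨h1, h2⟩; exact ⟨(x - s).toNat, by omega, by omega⟩

@[simp] lemma intSeg_nodup (s e : ℤ) : (intSeg s e).Nodup := by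
  refine List.Nodup.map ?_ List.nodup_range
  intro a b h
  simpa using h

@[simp] lemma length_intSeg (s e : ℤ) : (intSeg s e).length = (e + 1 - s).toNat := by
  simp [intSeg]

lemma head?_intSeg {s e : ℤ} (h : s ≤ e) : (intSeg s e).head? = some s := by
  have : 0 < (e + 1 - s).toNat := by omega
  rw [List.head?_eq_getElem?]
  simp [intSeg, this]

lemma getLast?_intSeg {s e : ℤ} (h : s ≤ e) : (intSeg s e).getLast? = some e := by
  have : 0 < (e + 1 - s).toNat := by omega
  rw [List.getLast?_eq_getElem?]
  simp [intSeg, this]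
  omega

lemma isChain_intSeg {R : ℤ → ℤ → Prop} (hR : ∀ t, R t (t + 1)) (s e : ℤ) :
    (intSeg s e).IsChain R := by
  rw [List.isChain_iff_getElem]
  intro i hi
  have := hR (s + i)
  simpa [intSeg, add_assoc] using this

lemma isChain_intSeg_reverse {R : ℤ → ℤ → Prop} (hR : ∀ t, R (t + 1) t) (s e : ℤ) :
    (intSeg s e).reverse.IsChain R := by
  rw [List.isChain_reverse]
  exact isChain_intSeg hR s e

variable {V : Type*} {G : SimpleGraph V}

/-- `l` lists the vertices of a cycle of `G`, in cyclic order. -/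
structure IsCyclicList (G : SimpleGraph V) (l : List V) : Prop where
  nodup : l.Nodup
  three_le : 3 ≤ l.length
  chain : l.IsChain G.Adj
  closed : ∀ x ∈ l.getLast?, ∀ y ∈ l.head?, G.Adj x y

/-- `c` runs periodically through a cycle of length `N`, and no cycle of `G` is longer. -/
structure IsLongestCycle (G : SimpleGraph V) (N : ℕ) (c : ℤ → V) : Prop where
  three_le : 3 ≤ N
  periodic : ∀ t, c (t + N) = c t
  inj : ∀ s t : ℤ, s ≤ t → t < s + N → c s = c t → s = t
  adj : ∀ t, G.Adj (c t) (c (t + 1))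
  max : ∀ l, IsCyclicList G l → l.length ≤ N

lemma IsCyclicList.exists_enum {l : List V} (hl : IsCyclicList G l) :
    ∃ c : ℤ → V, (∀ t, c (t + l.length) = c t) ∧
      (∀ s t : ℤ, s ≤ t → t < s + l.length → c s = c t → s = t) ∧
      ∀ t, G.Adj (c t) (c (t + 1)) := by
  have hN : 0 < (l.length : ℤ) := by have := hl.three_le; omega
  have hlt : ∀ t : ℤ, (t % l.length).toNat < l.length := fun t => by
    have := Int.emod_nonneg t hN.ne'
    have := Int.emod_lt_of_pos t hN
    omega
  refine ⟨fun t => l[(t % l.length).toNat]'(hlt t), ?_, ?_, ?_⟩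
  · intro t; simp
  · intro s t hst hts h
    have h1 := (List.Nodup.getElem_inj_iff hl.nodup).1 h
    have := Int.emod_nonneg t hN.ne'
    have := Int.emod_nonneg s hN.ne'
    have h2 : s % l.length = t % l.length := by omega
    have h4 : (t - s) % l.length = 0 := Int.emod_eq_emod_iff_emod_sub_eq_zero.1 h2.symm
    rw [Int.emod_eq_of_lt (by omega) (by omega)] at h4
    omega
  · intro t
    have h0 := Int.emod_nonneg t hN.ne'
    have h1 := Int.emod_lt_of_pos t hN
    have h3 := hl.three_le
    by_cases h : t % l.length + 1 = l.length
    · have e : (t + 1) % l.length = 0 := by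
        rw [← Int.emod_add_emod, h]; simp
      simp only [e]
      refine hl.closed _ ?_ _ ?_
      · rw [List.getLast?_eq_getElem?, Option.mem_def, List.getElem?_eq_some_iff]
        refine ⟨by omega, ?_⟩
        congr 1; omega
      · rw [List.head?_eq_getElem?, Option.mem_def, List.getElem?_eq_some_iff]
        exact ⟨by omega, by simp⟩
    · have e : ((t + 1) % l.length).toNat = (t % l.length).toNat + 1 := by
        rw [← Int.emod_add_emod, Int.emod_eq_of_lt (by omega) (by omega)]; omega
      simp only [e]
      exact hl.chain.getElem _ (by omega)

lemma exists_isLongestCycle [Fintype V] {l : List V} (hl : IsCyclicList G l) :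
    ∃ N c, IsLongestCycle G N c := by
  classical
  have hb : ∀ l, IsCyclicList G l → l.length ≤ Fintype.card V := fun l hl =>
    hl.nodup.length_le_card
  let P : ℕ → Prop := fun n => ∃ l, IsCyclicList G l ∧ l.length = n
  have hP : P (Nat.findGreatest P (Fintype.card V)) :=
    Nat.findGreatest_spec (hb l hl) ⟨l, hl, rfl⟩
  obtain ⟨m, hm, hmn⟩ := hP
  obtain ⟨c, h1, h2, h3⟩ := hm.exists_enum
  refine ⟨m.length, c, hm.three_le, h1, h2, h3, fun l' hl' => ?_⟩
  rw [hmn]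
  exact Nat.le_findGreatest (hb l' hl') ⟨l', hl', rfl⟩

namespace IsLongestCycle

variable {N : ℕ} {c : ℤ → V}

lemma reverse (hc : IsLongestCycle G N c) : IsLongestCycle G N fun t => c (-t) where
  three_le := hc.three_le
  periodic t := by rw [← hc.periodic]; congr 1; ring
  inj s t h1 h2 h := by have := hc.inj (-t) (-s) (by omega) (by omega) h.symm; omega
  adj t := by
    have := (hc.adj (-(t + 1))).symm
    rwa [show -(t + 1) + 1 = -t by ring] at this
  max := hc.max

/-- Moves a position into a prescribed period, keeping both cycle neighbours, so that positions can
be compared as integers. -/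
lemma exists_window (hc : IsLongestCycle G N c) (s t : ℤ) :
    ∃ u, s ≤ u ∧ u < s + N ∧ c u = c t ∧ c (u + 1) = c (t + 1) ∧ c (u - 1) = c (t - 1) := by
  have hN : 0 < (N : ℤ) := by have := hc.three_le; omega
  have h : ∀ m : ℤ, ∀ t, c (t + m * N) = c t := by
    intro m t
    induction m using Int.induction_on with
    | zero => simp
    | succ i ih => rw [← ih, ← hc.periodic (t + i * N)]; congr 1; ring
    | pred i ih => rw [← ih, ← hc.periodic (t + (-i - 1) * N)]; congr 1; ring
  have e := Int.mul_ediv_add_emod (t - s) N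
  have h0 := Int.emod_nonneg (t - s) hN.ne'
  have h1 := Int.emod_lt_of_pos (t - s) hN
  refine ⟨s + (t - s) % N, by omega, by omega, ?_, ?_, ?_⟩
  · rw [← h ((t - s) / N)]; congr 1; linarith
  · rw [← h ((t - s) / N)]; congr 1; linarith
  · rw [← h ((t - s) / N)]; congr 1; linarith

lemma sub_periodic (hc : IsLongestCycle G N c) (t : ℤ) : c (t - N) = c t := by
  rw [← hc.periodic]; congr 1; ring

lemma injOn_window (hc : IsLongestCycle G N c) {L : List ℤ} {w : ℤ}
    (hL : ∀ t ∈ L, w ≤ t ∧ t < w + N) : ∀ x ∈ L, ∀ y ∈ L, c x = c y → x = y := by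
  intro x hx y hy h
  have := hL x hx; have := hL y hy
  rcases le_total x y with h' | h'
  · exact hc.inj _ _ h' (by omega) h
  · exact (hc.inj _ _ h' (by omega) h.symm).symm

/-- A spanning path of a longest cycle cannot be closed up through vertices off the cycle. -/
lemma not_closable (hc : IsLongestCycle G N c) {P : List V} (hP : P ≠ []) (hPn : P.Nodup)
    (hPc : ∀ v ∈ P, ∀ t, c t ≠ v) (hPch : P.IsChain G.Adj) {L : List ℤ} {w a b : ℤ}
    (hL : L.Nodup) (hLw : ∀ t ∈ L, w ≤ t ∧ t < w + N) (hlen : N ≤ L.length)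
    (hLch : L.IsChain fun s t => G.Adj (c s) (c t))
    (ha : L.head? = some a) (hb : L.getLast? = some b)
    (hPa : ∀ v ∈ P.getLast?, G.Adj v (c a)) (hPb : ∀ v ∈ P.head?, G.Adj (c b) v) : False := by
  have hpos := List.length_pos_iff.2 hP
  have hN := hc.three_le
  have hcl : IsCyclicList G (P ++ L.map c) := by
    refine ⟨?_, ?_, ?_, ?_⟩
    · rw [List.nodup_append]
      refine ⟨hPn, ?_, ?_⟩
      · exact List.Nodup.map_on (fun x hx y hy h => hc.injOn_window hLw x hx y hy h) hL
      · intro v hv y hy h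
        obtain ⟨t, -, rfl⟩ := List.mem_map.1 hy
        exact hPc v hv t h.symm
    · simp; omega
    · rw [List.isChain_append]
      refine ⟨hPch, (List.isChain_map c).2 hLch, ?_⟩
      intro x hx y hy
      simp [ha] at hy
      subst hy
      exact hPa x hx
    · intro x hx y hy
      have hLne : L.map c ≠ [] := by rintro h; simp at h; simp [h] at ha
      rw [List.getLast?_append_of_ne_nil _ hLne] at hx
      rw [List.head?_append_of_ne_nil _ hP] at hy
      simp [hb] at hx
      subst hx
      exact hPb y hy
  have := hc.max _ hcl
  simp at this
  omega

end IsLongestCycle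

end SimpleGraph

/-! ### Consequences of freeness and connectivity -/

namespace SimpleGraph

variable {V : Type*} {G : SimpleGraph V}

lemma IsInducedFree.card_lt {k : ℕ} (hfree : G.IsInducedFree (pathTwoUnionIsolated k)) {u v : V}
    (huv : G.Adj u v) {T : Finset V}
    (hT : ∀ a ∈ T, a ≠ u ∧ a ≠ v ∧ ¬ G.Adj u a ∧ ¬ G.Adj v a)
    (hind : ∀ a ∈ T, ∀ b ∈ T, ¬ G.Adj a b) : T.card < k := by
  by_contra! hk
  apply hfree
  obtain ⟨T', hT', hcard⟩ := Finset.exists_subset_card_eq hk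
  let e := T'.equivFinOfCardEq hcard
  have hm : ∀ i, (e.symm i : V) ∈ T := fun i => hT' (e.symm i).2
  let f : Fin 2 ⊕ Fin k → V := Sum.elim ![u, v] fun i => e.symm i
  have hne := huv.ne
  have hinj : Function.Injective f := by
    rintro (i | i) (j | j) h
    · fin_cases i <;> fin_cases j <;> simp_all [f]
    · have := hT _ (hm j)
      fin_cases i <;> simp [f] at h <;> simp [← h] at this
    · have := hT _ (hm i)
      fin_cases j <;> simp [f] at h <;> simp [h] at this
    · simpa [f, Subtype.ext_iff] using h
  refine ⟨⟨⟨f, hinj⟩, ?_⟩⟩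
  rintro (i | i) (j | j)
  · fin_cases i <;> fin_cases j <;> simp [f, pathTwoUnionIsolated, huv, huv.symm, pathGraph_adj]
  · have := hT _ (hm j)
    fin_cases i <;> simp [f, pathTwoUnionIsolated, this]
  · have := hT _ (hm i)
    fin_cases j <;> simp [f, pathTwoUnionIsolated, this, G.adj_comm (e.symm i : V)]
  · simp [f, pathTwoUnionIsolated, hind _ (hm i) _ (hm j)]

lemma exists_list_of_reachable {s : Set V} {p q : s} (h : (G.induce s).Reachable p q) :
    ∃ P : List V, P ≠ [] ∧ P.Nodup ∧ (∀ v ∈ P, v ∈ s) ∧ P.IsChain G.Adj ∧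
      P.head? = some ↑p ∧ P.getLast? = some ↑q := by
  classical
  obtain ⟨w⟩ := h
  let w' := w.toPath
  refine ⟨(w' : (G.induce s).Walk p q).support.map Subtype.val,
    by rw [Ne, List.map_eq_nil_iff]; exact Walk.support_ne_nil _, ?_, ?_, ?_, ?_, ?_⟩
  · exact w'.2.support_nodup.map Subtype.val_injective
  · intro v hv
    obtain ⟨x, -, rfl⟩ := List.mem_map.1 hv
    exact x.2
  · rw [List.isChain_map]
    exact (w' : (G.induce s).Walk p q).isChain_adj_support
  · rw [List.head?_map, List.head?_eq_some_head (Walk.support_ne_nil _), Walk.head_support]; rfl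
  · rw [List.getLast?_map, List.getLast?_eq_some_getLast (Walk.support_ne_nil _),
      Walk.getLast_support]; rfl

/-- A set separating `H` from a vertex outside has at least `m` elements. -/
lemma IsKConnected.le_card {m : ℕ} (hG : G.IsKConnected m) {H : Set V} {S : Finset V} {h x : V}
    (hH : h ∈ H) (hS : h ∉ S) (hxH : x ∉ H) (hxS : x ∉ S)
    (hcl : ∀ v ∈ H, ∀ w, G.Adj v w → w ∈ H ∨ w ∈ S) : m ≤ S.card := by
  by_contra! hlt
  have hreach := (hG.2 S hlt).preconnected ⟨h, by simpa using hS⟩ ⟨x, by simpa using hxS⟩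
  obtain ⟨w⟩ := hreach
  have key : ∀ (a b : ((S : Set V)ᶜ : Set V)), (G.induce ((S : Set V)ᶜ)).Walk a b →
      (a : V) ∈ H → (b : V) ∈ H := by
    intro a b w
    induction w with
    | nil => exact id
    | @cons a b c hab _ ih =>
      intro ha
      refine ih ?_
      rcases hcl _ ha _ (comap_adj.1 hab) with h | h
      · exact h
      · exact absurd h b.2
  exact hxH (key _ _ w hH)

/-- A vertex has two neighbours, as a single one would separate it from the rest; a path between
them avoiding the vertex closes up through it. -/
lemma IsKConnected.exists_isCyclicList {m : ℕ} (hG : G.IsKConnected m) (hm : 3 ≤ m) :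
    ∃ l, IsCyclicList G l := by
  classical
  obtain ⟨v⟩ := hG.1.nonempty
  have hne : ∀ S : Finset V, S.card < m → ∃ x, x ∉ S := fun S hS => by
    obtain ⟨x⟩ := (hG.2 S hS).nonempty
    exact ⟨x, x.2⟩
  have hdeg : ∀ y, y ≠ v → ∃ a, G.Adj v a ∧ a ≠ y := by
    intro y hy
    by_contra! hcon
    obtain ⟨x, hx⟩ := hne {v, y} (Finset.card_le_two.trans_lt (by omega))
    have := hG.le_card (H := {v}) (S := {y}) (h := v) (x := x) rfl (by simpa using hy.symm)
      (by rintro rfl; simp at hx) (by rintro h; simp_all)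
      (by rintro _ rfl w hw; right; simpa using hcon w hw)
    simp at this
    omega
  obtain ⟨y, hy⟩ := hne {v} (by simp; omega)
  obtain ⟨a, hva, -⟩ := hdeg y (by simpa using hy)
  obtain ⟨b, hvb, hab⟩ := hdeg a hva.ne'
  obtain ⟨P, hP, hPn, hPs, hPch, hPh, hPl⟩ := exists_list_of_reachable
    ((hG.2 {v} (by simp; omega)).preconnected ⟨a, by simpa using hva.ne'⟩
      ⟨b, by simpa using hvb.ne'⟩)
  refine ⟨v :: P, ?_, ?_, ?_, ?_⟩
  · refine List.nodup_cons.2 ⟨fun h => ?_, hPn⟩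
    simpa using hPs v h
  · match P with
    | [] => simp at hP
    | [x] => simp at hPh hPl; exact absurd (hPl.symm.trans hPh) hab
    | x :: y :: l => simp
  · rw [List.isChain_cons]
    refine ⟨?_, hPch⟩
    simpa [hPh] using hva
  · intro x hx y hy
    rw [List.getLast?_cons_of_ne_nil hP] at hx
    simp [hPl] at hx hy
    subst hx hy
    exact hvb.symm

/-! ### Ears and reroutings of a longest cycle -/

/-- The vertices `c a` and `c b` are joined by a path whose inner vertices, at least one, avoid
the range of `c`. -/
def EarJoined (G : SimpleGraph V) (c : ℤ → V) (a b : ℤ) : Prop :=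
  ∃ P : List V, P ≠ [] ∧ P.Nodup ∧ (∀ v ∈ P, ∀ t, c t ≠ v) ∧ P.IsChain G.Adj ∧
    (∀ v ∈ P.head?, G.Adj (c a) v) ∧ ∀ v ∈ P.getLast?, G.Adj v (c b)

lemma EarJoined.of_adj {c : ℤ → V} {h : V} (hoff : ∀ t, c t ≠ h) {a b : ℤ}
    (ha : G.Adj h (c a)) (hb : G.Adj h (c b)) : EarJoined G c a b :=
  ⟨[h], by simp, by simp, by simpa using hoff, by simp, by simpa using ha.symm, by simpa using hb⟩

lemma EarJoined.of_reachable {c : ℤ → V} {p q : ((Set.range c)ᶜ : Set V)}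
    (h : (G.induce (Set.range c)ᶜ).Reachable p q) {a b : ℤ}
    (ha : G.Adj p (c a)) (hb : G.Adj q (c b)) : EarJoined G c a b := by
  obtain ⟨P, hP, hPn, hPs, hPch, hPh, hPl⟩ := exists_list_of_reachable h
  refine ⟨P, hP, hPn, fun v hv t e => hPs v hv ⟨t, e⟩, hPch, ?_, ?_⟩
  · simpa [hPh] using ha.symm
  · simpa [hPl] using hb

namespace IsLongestCycle

variable {N : ℕ} {c : ℤ → V}

lemma adj_symm (hc : IsLongestCycle G N c) (t : ℤ) : G.Adj (c (t + 1)) (c t) := (hc.adj t).symm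

lemma not_closable_of_earJoined (hc : IsLongestCycle G N c) {a b : ℤ} (h : EarJoined G c a b)
    {L : List ℤ} {w : ℤ}
    (hL : L.Nodup) (hLw : ∀ t ∈ L, w ≤ t ∧ t < w + N) (hlen : N ≤ L.length)
    (hLch : L.IsChain fun s t => G.Adj (c s) (c t))
    (hb : L.head? = some b) (ha : L.getLast? = some a ∨ L.getLast? = some (a + N)) : False := by
  obtain ⟨P, hP, hPn, hPs, hPch, hPh, hPl⟩ := h
  rcases ha with ha | ha
  · exact hc.not_closable hP hPn hPs hPch hL hLw hlen hLch hb ha hPl hPh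
  · exact hc.not_closable hP hPn hPs hPch hL hLw hlen hLch hb ha hPl
      (by simpa only [hc.periodic] using hPh)

lemma not_earJoined_succ (hc : IsLongestCycle G N c) (a : ℤ) : ¬ EarJoined G c a (a + 1) := by
  intro h
  have := hc.three_le
  refine hc.not_closable_of_earJoined h (L := intSeg (a + 1) (a + N)) (w := a + 1) (by simp) ?_
    (by simp) (isChain_intSeg hc.adj _ _) (head?_intSeg (by omega))
    (.inr (getLast?_intSeg (by omega)))
  simp only [mem_intSeg]; omega

/-- Otherwise follow the ear to `c b`, go back to `c (a + 1)`, take the chord to `c (b + 1)` and go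
on to `c (a + N) = c a`. -/
lemma not_adj_succ (hc : IsLongestCycle G N c) {a b : ℤ} (h : EarJoined G c a b) (hab : a < b)
    (hba : b < a + N) : ¬ G.Adj (c (a + 1)) (c (b + 1)) := by
  intro h'
  refine hc.not_closable_of_earJoined h
    (L := (intSeg (a + 1) b).reverse ++ intSeg (b + 1) (a + N)) (w := a + 1) ?_ ?_
    (by simp; omega) ?_ ?_ (.inr ?_)
  · simp only [List.nodup_append, List.nodup_reverse, intSeg_nodup, List.mem_reverse, mem_intSeg,
      true_and]
    omega
  · simp only [List.mem_append, List.mem_reverse, mem_intSeg]; omega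
  · refine (isChain_intSeg_reverse hc.adj_symm _ _).append (isChain_intSeg hc.adj _ _) ?_
    rw [List.getLast?_reverse, head?_intSeg (by omega), head?_intSeg (by omega)]
    simpa using h'
  · rw [List.head?_append, List.head?_reverse, getLast?_intSeg (by omega)]; rfl
  · rw [List.getLast?_append, getLast?_intSeg (by omega)]; rfl

/-- The longer cycle takes the ear to `c b`, goes back to `c (a + 1)`, jumps to `c t`, goes back to
`c (b + 1)`, jumps to `c (t + 1)` and goes on to `c (a + N) = c a`. -/
lemma not_crossing (hc : IsLongestCycle G N c) {a b t : ℤ} (h : EarJoined G c a b) (hab : a < b)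
    (hbt : b + 1 ≤ t) (hta : t + 1 ≤ a + N) (h1 : G.Adj (c (b + 1)) (c (t + 1)))
    (h2 : G.Adj (c (a + 1)) (c t)) : False := by
  refine hc.not_closable_of_earJoined h
    (L := (intSeg (a + 1) b).reverse ++ ((intSeg (b + 1) t).reverse ++ intSeg (t + 1) (a + N)))
    (w := a + 1) ?_ ?_ (by simp; omega) ?_ ?_ (.inr ?_)
  · simp only [List.nodup_append, List.nodup_reverse, intSeg_nodup, List.mem_reverse, mem_intSeg,
      true_and, List.mem_append]
    refine ⟨?_, ?_⟩ <;> intro x hx y hy <;> omega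
  · simp only [List.mem_append, List.mem_reverse, mem_intSeg]; omega
  · refine (isChain_intSeg_reverse hc.adj_symm _ _).append
      ((isChain_intSeg_reverse hc.adj_symm _ _).append (isChain_intSeg hc.adj _ _) ?_) ?_
    · rw [List.getLast?_reverse, head?_intSeg (by omega), head?_intSeg (by omega)]
      simpa using h1
    · rw [List.getLast?_reverse, head?_intSeg (by omega), List.head?_append, List.head?_reverse,
        getLast?_intSeg (by omega)]
      simpa using h2
  · rw [List.head?_append, List.head?_reverse, getLast?_intSeg (by omega)]; rfl
  · rw [List.getLast?_append, List.getLast?_append, getLast?_intSeg (by omega)]; rfl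

/-- As in `not_adj_succ`, with the path through `r` in place of the chord: the new cycle has length
`N + 2`. -/
lemma not_adj_two_succ (hc : IsLongestCycle G N c) {h r : V} (hoff : ∀ t, c t ≠ h)
    (roff : ∀ t, c t ≠ r) (hr : h ≠ r) {a b : ℤ} (ha : G.Adj h (c a)) (hb : G.Adj h (c b))
    (hab : a < b) (hba : b < a + N) (hra : G.Adj r (c (a + 1))) (hrb : G.Adj r (c (b + 1))) :
    False := by
  have hw : ∀ t ∈ intSeg (a + 1) b ++ intSeg (b + 1) (a + N), a + 1 ≤ t ∧ t < a + 1 + N := by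
    simp only [List.mem_append, mem_intSeg]; omega
  have hinj := hc.injOn_window hw
  have hl : IsCyclicList G
      (h :: ((intSeg (a + 1) b).reverse.map c ++ r :: (intSeg (b + 1) (a + N)).map c)) := by
    refine ⟨?_, ?_, ?_, ?_⟩
    · simp only [List.nodup_cons, List.nodup_append, List.mem_append, List.mem_map,
        List.mem_reverse, mem_intSeg, List.mem_cons, not_or, not_exists, not_and]
      refine ⟨⟨fun t _ => hoff t, hr, fun t _ => hoff t⟩, ?_, ⟨fun t _ => roff t, ?_⟩, ?_⟩
      · refine List.Nodup.map_on (fun x hx y hy => hinj x ?_ y ?_) (by simp)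
        · rw [List.mem_reverse] at hx; exact List.mem_append_left _ hx
        · rw [List.mem_reverse] at hy; exact List.mem_append_left _ hy
      · refine List.Nodup.map_on (fun x hx y hy => hinj x ?_ y ?_) (by simp)
        · exact List.mem_append_right _ hx
        · exact List.mem_append_right _ hy
      · rintro _ ⟨s, hs, rfl⟩ _ (rfl | ⟨t, ht, rfl⟩)
        · exact roff s
        · intro e
          have := hinj s (List.mem_append_left _ (mem_intSeg.2 hs)) t
            (List.mem_append_right _ (mem_intSeg.2 ht)) e
          omega
    · simp; omega
    · rw [List.isChain_cons]
      constructor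
      · rw [List.head?_append, List.head?_map, List.head?_reverse, getLast?_intSeg (by omega)]
        simpa using hb
      · refine List.IsChain.append ?_ ?_ ?_
        · rw [List.isChain_map]; exact isChain_intSeg_reverse hc.adj_symm _ _
        · rw [List.isChain_cons, List.isChain_map]
          refine ⟨?_, isChain_intSeg hc.adj _ _⟩
          rw [List.head?_map, head?_intSeg (by omega)]
          simpa using hrb
        · rw [List.getLast?_map, List.getLast?_reverse, head?_intSeg (by omega)]
          simpa using hra.symm
    · have : ∀ l : List V, l ≠ [] → (h :: ((intSeg (a + 1) b).reverse.map c ++ r :: l)).getLast? =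
          l.getLast? := by
        intro l hl
        obtain ⟨x, l, rfl⟩ := List.exists_cons_of_ne_nil hl
        simp [List.getLast?_cons, List.getLast?_append]
      rw [this, List.getLast?_map, getLast?_intSeg (by omega)]
      · simpa [hc.periodic] using ha.symm
      · intro e
        have := congrArg List.length e
        simp at this
        omega
  have := hc.max _ hl
  simp at this
  omega

end IsLongestCycle

end SimpleGraph

/-! ### The independent set of successors, and consecutive heavy vertices -/

namespace SimpleGraph

variable {V : Type*} {G : SimpleGraph V} {N : ℕ} {c : ℤ → V} {h : V} {k d : ℕ}

open Classical in
/-- The positions in `[s, e)` at which `h` is adjacent to `c`. -/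
noncomputable def attachments (G : SimpleGraph V) (c : ℤ → V) (h : V) (s e : ℤ) : Finset ℤ :=
  (Finset.Ico s e).filter fun t => G.Adj h (c t)

lemma mem_attachments {s e t : ℤ} :
    t ∈ attachments G c h s e ↔ (s ≤ t ∧ t < e) ∧ G.Adj h (c t) := by
  simp [attachments]

open Classical in
/-- The vertex `h` together with the successors on `c` of its neighbours. -/
noncomputable def successors (G : SimpleGraph V) (N : ℕ) (c : ℤ → V) (h : V) : Finset V :=
  insert h ((attachments G c h 0 N).image fun t => c (t + 1))

lemma self_mem_successors : h ∈ successors G N c h := by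
  simp [successors]

/-- A longest cycle `c` with a vertex `h` off it that has `d ≥ 2k - 2` neighbours on `c`, in a graph without induced `P₂ ∪ kP₁`. -/
structure Attached (G : SimpleGraph V) (N : ℕ) (c : ℤ → V) (h : V) (k d : ℕ) : Prop where
  cyc : IsLongestCycle G N c
  off : ∀ t, c t ≠ h
  three_le : 3 ≤ k
  deg : 2 * k ≤ d + 2
  count : ∀ s, (attachments G c h s (s + N)).card = d
  free : ∀ u v, G.Adj u v → ∀ T : Finset V,
    (∀ a ∈ T, a ≠ u ∧ a ≠ v ∧ ¬ G.Adj u a ∧ ¬ G.Adj v a) →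
    (∀ a ∈ T, ∀ b ∈ T, ¬ G.Adj a b) → T.card < k

/-- The position `a` is the last neighbour of `h` before position `b`. -/
def Consecutive (G : SimpleGraph V) (c : ℤ → V) (h : V) (a b : ℤ) : Prop :=
  a < b ∧ G.Adj h (c a) ∧ G.Adj h (c b) ∧ ∀ s, a < s → s < b → ¬ G.Adj h (c s)

namespace Attached

lemma earJoined (H : Attached G N c h k d) {a b : ℤ} (ha : G.Adj h (c a)) (hb : G.Adj h (c b)) :
    EarJoined G c a b := .of_adj H.off ha hb

lemma mem_successors (H : Attached G N c h k d) {v : V} :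
    v ∈ successors G N c h ↔ v = h ∨ ∃ t, G.Adj h (c t) ∧ v = c (t + 1) := by
  simp only [successors, Finset.mem_insert, Finset.mem_image, mem_attachments]
  refine or_congr_right ⟨?_, ?_⟩
  · rintro ⟨t, ⟨-, ht⟩, rfl⟩; exact ⟨t, ht, rfl⟩
  · rintro ⟨t, ht, rfl⟩
    obtain ⟨u, h0, h1, h2, h3, -⟩ := H.cyc.exists_window 0 t
    exact ⟨u, ⟨⟨h0, by omega⟩, by rwa [h2]⟩, h3⟩

lemma succ_mem (H : Attached G N c h k d) {t : ℤ} (ht : G.Adj h (c t)) :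
    c (t + 1) ∈ successors G N c h := H.mem_successors.2 (.inr ⟨t, ht, rfl⟩)

lemma card_successors (H : Attached G N c h k d) : (successors G N c h).card = d + 1 := by
  classical
  rw [successors, Finset.card_insert_of_notMem, Finset.card_image_of_injOn]
  · have := H.count 0; rw [zero_add] at this; rw [this]
  · intro x hx y hy e
    simp only [Finset.mem_coe, mem_attachments] at hx hy
    rcases le_total x y with h' | h'
    · have := H.cyc.inj _ _ (by omega) (by omega) e; omega
    · have := H.cyc.inj _ _ (by omega) (by omega) e.symm; omega
  · simp only [Finset.mem_image, not_exists, not_and]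
    exact fun t _ => H.off _

lemma not_adj_succ (H : Attached G N c h k d) {t : ℤ} (ht : G.Adj h (c t)) :
    ¬ G.Adj h (c (t + 1)) := fun h' => H.cyc.not_earJoined_succ t (H.earJoined ht h')

lemma independent (H : Attached G N c h k d) {a b : V} (ha : a ∈ successors G N c h)
    (hb : b ∈ successors G N c h) : ¬ G.Adj a b := by
  rw [H.mem_successors] at ha hb
  obtain rfl | ⟨s, hs, rfl⟩ := ha
  · obtain rfl | ⟨t, ht, rfl⟩ := hb
    · exact G.irrefl
    · exact H.not_adj_succ ht
  · obtain rfl | ⟨t, ht, rfl⟩ := hb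
    · exact fun h' => H.not_adj_succ hs h'.symm
    · obtain ⟨u, h0, h1, h2, h3, -⟩ := H.cyc.exists_window s t
      rw [← h3]
      rw [← h2] at ht
      rcases h0.eq_or_lt with rfl | h0
      · exact G.irrefl
      · exact H.cyc.not_adj_succ (H.earJoined hs ht) h0 h1

-- The edge `u a` and the non-neighbours of `u` among the successors form an induced `P₂ ∪ jP₁`, so
-- there are fewer than `k` of the latter.
open Classical in
lemma le_card_filter (H : Attached G N c h k d) {u a : V} (ha : a ∈ successors G N c h)
    (hu : G.Adj u a) : d + 2 ≤ k + ((successors G N c h).filter (G.Adj u)).card := by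
  have huA : u ∉ successors G N c h := fun h' => H.independent h' ha hu
  have := H.free u a hu ((successors G N c h).filter fun v => ¬ G.Adj u v) ?_ ?_
  · have h2 := Finset.card_filter_add_card_filter_not (s := successors G N c h) (G.Adj u)
    rw [H.card_successors] at h2
    omega
  · intro v hv
    rw [Finset.mem_filter] at hv
    refine ⟨?_, ?_, hv.2, H.independent ha hv.1⟩
    · rintro rfl; exact huA hv.1
    · rintro rfl; exact hv.2 hu
  · intro v hv w hw
    rw [Finset.mem_filter] at hv hw
    exact H.independent hv.1 hw.1

lemma exists_adj_of_adj (H : Attached G N c h k d) {u v : V} (huv : G.Adj u v) :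
    ∃ a ∈ successors G N c h, G.Adj u a ∨ G.Adj v a := by
  by_contra! hcon
  have := H.free u v huv (successors G N c h) ?_ fun a ha b hb => H.independent ha hb
  · rw [H.card_successors] at this
    have := H.deg; have := H.three_le
    omega
  · intro a ha
    refine ⟨?_, ?_, hcon a ha⟩
    · rintro rfl; exact (hcon a ha).2 huv.symm
    · rintro rfl; exact (hcon a ha).1 huv

lemma reverse (H : Attached G N c h k d) : Attached G N (fun t => c (-t)) h k d where
  cyc := H.cyc.reverse
  off t := H.off _
  three_le := H.three_le
  deg := H.deg
  count s := by
    -- Negation sends `[s, s + N)` to `(-s - N, -s]`, whence the shift by one.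
    rw [← H.count (-s - N + 1)]
    refine Finset.card_bij (fun t _ => -t) ?_ ?_ ?_
    · intro t ht
      rw [mem_attachments] at ht ⊢
      exact ⟨by omega, ht.2⟩
    · intro a _ b _ e; omega
    · intro t ht
      rw [mem_attachments] at ht
      exact ⟨-t, mem_attachments.2 ⟨by omega, by simpa using ht.2⟩, by simp⟩
  free := H.free

lemma exists_prev (H : Attached G N c h k d) (t : ℤ) :
    ∃ a, a < t ∧ t ≤ a + N ∧ G.Adj h (c a) ∧ ∀ s, a < s → s < t → ¬ G.Adj h (c s) := by
  have hd : 0 < (attachments G c h (t - N) (t - N + N)).card := by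
    rw [H.count]; have := H.deg; have := H.three_le; omega
  have hne := Finset.card_pos.1 hd
  have hm := Finset.max'_mem _ hne
  set a := Finset.max' _ hne
  rw [mem_attachments] at hm
  refine ⟨a, by omega, by omega, hm.2, fun s h1 h2 h3 => ?_⟩
  have : s ≤ a := Finset.le_max' _ s (mem_attachments.2 ⟨by omega, h3⟩)
  omega

open Classical in
/-- If two consecutive vertices of the cycle have neighbours among the successors, then they end
a segment between neighbours of `h`, and some of their neighbours are known. -/
lemma structure_of_adj_adj (H : Attached G N c h k d) {a t : ℤ}
    (hat : a < t) (hta : t ≤ a + N) (ha : G.Adj h (c a))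
    (hgap : ∀ s, a < s → s < t → ¬ G.Adj h (c s))
    (h0 : ∃ v ∈ successors G N c h, G.Adj (c t) v)
    (h1 : ∃ v ∈ successors G N c h, G.Adj (c (t + 1)) v) :
    Consecutive G c h a (t + 1) ∧ G.Adj (c t) (c (a + 1)) ∧
      (∀ w, Consecutive G c h (t + 1) w → G.Adj (c (t + 1)) (c (w + 1))) ∧
      ∀ l, Consecutive G c h l a → G.Adj (c t) (c (l + 1)) := by
  obtain ⟨v0, hv0, htv0⟩ := h0
  obtain ⟨v1, hv1, htv1⟩ := h1
  have hk := H.three_le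
  have hd := H.deg
  have ht : ¬ G.Adj h (c t) := fun h' => H.independent (H.succ_mem h') hv1 htv1
  have htN : t < a + N := by
    refine lt_of_le_of_ne hta ?_
    rintro rfl
    rw [H.cyc.periodic] at ht
    exact ht ha
  -- One period of the neighbours of `h`, with `c a` left out.
  set W := attachments G c h (t + 1) (a + N) with hW
  have hWa : attachments G c h a (a + N) = insert a W := by
    ext s
    simp only [Finset.mem_insert, hW, mem_attachments]
    constructor
    · rintro ⟨⟨h1, h2⟩, h3⟩
      rcases h1.eq_or_lt with h1 | h1
      · exact .inl h1.symm
      · right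
        refine ⟨⟨?_, h2⟩, h3⟩
        by_contra! h4
        rcases (show s ≤ t by omega).eq_or_lt with rfl | h5
        · exact ht h3
        · exact hgap s h1 h5 h3
    · rintro (rfl | h1)
      · exact ⟨by omega, ha⟩
      · exact ⟨by omega, h1.2⟩
  have hWcard : W.card + 1 = d := by
    rw [← H.count a, hWa, Finset.card_insert_of_notMem]
    simp only [hW, mem_attachments]; omega
  set U := W.filter fun b => G.Adj (c t) (c (b + 1)) with hU
  set U' := W.filter fun b => G.Adj (c (t + 1)) (c (b + 1)) with hU'
  have hrep : ∀ v ∈ successors G N c h, v = h ∨ v = c (a + 1) ∨ ∃ b ∈ W, v = c (b + 1) := by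
    intro v hv
    rw [H.mem_successors] at hv
    obtain rfl | ⟨s, hs, rfl⟩ := hv
    · exact .inl rfl
    · obtain ⟨u, e0, e1, e2, e3, -⟩ := H.cyc.exists_window a s
      have : u ∈ attachments G c h a (a + N) := mem_attachments.2 ⟨⟨e0, e1⟩, by rwa [e2]⟩
      rw [hWa, Finset.mem_insert] at this
      obtain rfl | hu := this
      · exact .inr (.inl e3.symm)
      · exact .inr (.inr ⟨u, hu, e3.symm⟩)
  -- A pair `α < β`, moved back by one period, would be the forbidden crossing.
  have hle : ∀ β ∈ U', ∀ α ∈ U, β ≤ α := by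
    intro β hβ α hα
    simp only [hU, hU', Finset.mem_filter, hW, mem_attachments] at hβ hα
    by_contra! hlt
    refine H.cyc.not_crossing (a := α - N) (b := β - N) (t := t)
      (H.earJoined ?_ ?_) (by omega) (by omega) (by omega) ?_ ?_
    · rw [H.cyc.sub_periodic]; exact hα.1.2
    · rw [H.cyc.sub_periodic]; exact hβ.1.2
    · rw [show β - N + 1 = β + 1 - N by ring, H.cyc.sub_periodic]; exact hβ.2.symm
    · rw [show α - N + 1 = α + 1 - N by ring, H.cyc.sub_periodic]; exact hα.2.symm
  have hcard0 := H.le_card_filter hv0 htv0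
  have hcard1 := H.le_card_filter hv1 htv1
  have hUsub : (successors G N c h).filter (G.Adj (c t)) ⊆
      (U.image fun b => c (b + 1)) ∪ if G.Adj (c t) (c (a + 1)) then {c (a + 1)} else ∅ := by
    intro v hv
    rw [Finset.mem_filter] at hv
    rw [Finset.mem_union]
    obtain rfl | rfl | ⟨b, hb, rfl⟩ := hrep v hv.1
    · exact absurd hv.2.symm ht
    · right; simp [hv.2]
    · left; exact Finset.mem_image_of_mem _ (Finset.mem_filter.2 ⟨hb, hv.2⟩)
  have hUcard : d + 2 ≤ k + (U.card + if G.Adj (c t) (c (a + 1)) then 1 else 0) := by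
    refine hcard0.trans (Nat.add_le_add_left ((Finset.card_le_card hUsub).trans
      ((Finset.card_union_le _ _).trans (Nat.add_le_add Finset.card_image_le ?_))) _)
    split_ifs <;> simp
  have hUpos : 0 < U.card := by split_ifs at hUcard <;> omega
  obtain ⟨α, hα⟩ := Finset.card_pos.1 hUpos
  -- Again a crossing, now with the ear from `α - N` to `a` for some `α ∈ U`.
  have hya : ¬ G.Adj (c (t + 1)) (c (a + 1)) := by
    intro h'
    simp only [hU, Finset.mem_filter, hW, mem_attachments] at hα
    refine H.cyc.not_crossing (a := α - N) (b := a) (t := t)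
      (H.earJoined ?_ ha) (by omega) (by omega) (by omega) h'.symm ?_
    · rw [H.cyc.sub_periodic]; exact hα.1.2
    · rw [show α - N + 1 = α + 1 - N by ring, H.cyc.sub_periodic]; exact hα.2.symm
  have hUsub' : (successors G N c h).filter (G.Adj (c (t + 1))) ⊆
      (U'.image fun b => c (b + 1)) ∪ if G.Adj h (c (t + 1)) then {h} else ∅ := by
    intro v hv
    rw [Finset.mem_filter] at hv
    rw [Finset.mem_union]
    obtain rfl | rfl | ⟨b, hb, rfl⟩ := hrep v hv.1
    · right; simp [hv.2.symm]
    · exact absurd hv.2 hya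
    · left; exact Finset.mem_image_of_mem _ (Finset.mem_filter.2 ⟨hb, hv.2⟩)
  have hUcard' : d + 2 ≤ k + (U'.card + if G.Adj h (c (t + 1)) then 1 else 0) := by
    refine hcard1.trans (Nat.add_le_add_left ((Finset.card_le_card hUsub').trans
      ((Finset.card_union_le _ _).trans (Nat.add_le_add Finset.card_image_le ?_))) _)
    split_ifs <;> simp
  have hunion : U ∪ U' ⊆ W :=
    Finset.union_subset (Finset.filter_subset _ _) (Finset.filter_subset _ _)
  have hinter : (U ∩ U').card ≤ 1 := by
    rw [Finset.card_le_one]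
    intro x hx y hy
    rw [Finset.mem_inter] at hx hy
    exact le_antisymm (hle x hx.2 y hy.1) (hle y hy.2 x hx.1)
  -- Now `|U| + |U'| ≤ (d - 1) + 1`, while heaviness asks for `2 * (d + 2 - k) ≥ d + 2` neighbours
  -- in all. Only the edges from `c t` to `c (a + 1)` and from `c (t + 1)` to `h` can supply the
  -- missing two, so both exist and `U ∪ U'` is all of `W`.
  have hcu := Finset.card_le_card hunion
  have hci := Finset.card_union_add_card_inter U U'
  have hadj : G.Adj (c t) (c (a + 1)) := by
    by_contra h'
    rw [if_neg h'] at hUcard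
    split_ifs at hUcard' <;> omega
  rw [if_pos hadj] at hUcard
  have hX : G.Adj h (c (t + 1)) := by
    by_contra h'
    rw [if_neg h'] at hUcard'
    omega
  rw [if_pos hX] at hUcard'
  have hWeq : U ∪ U' = W := Finset.eq_of_subset_of_card_le hunion (by omega)
  refine ⟨⟨by omega, ha, hX, ?_⟩, hadj, ?_, ?_⟩
  · intro s h1 h2
    rcases (show s ≤ t by omega).eq_or_lt with rfl | h3
    · exact ht
    · exact hgap s h1 h3
  · rintro w ⟨h1, -, hw, h2⟩
    by_contra hcon
    have hwW : w ∈ W := by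
      refine mem_attachments.2 ⟨⟨by omega, ?_⟩, hw⟩
      by_contra! h3
      have : W ⊆ {t + 1} := by
        intro s hs
        rw [hW, mem_attachments] at hs
        rw [Finset.mem_singleton]
        by_contra h4
        exact h2 s (by omega) (by omega) hs.2
      have := Finset.card_le_card this
      simp at this
      omega
    have hwU' : w ∉ U' := fun h' => hcon (Finset.mem_filter.1 h').2
    have hwU : w ∈ U := by
      rw [← hWeq, Finset.mem_union] at hwW
      exact hwW.resolve_right hwU'
    -- All of `U'` would precede `w`, the first attachment after `t + 1`; but `U'` has at least `k -
    -- 1 ≥ 2` elements.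
    have : U' ⊆ {t + 1} := by
      intro s hs
      have hs1 := hle s hs w hwU
      have hs2 : s ≠ w := by rintro rfl; exact hwU' hs
      have hs3 := mem_attachments.1 (Finset.mem_filter.1 hs).1
      rw [Finset.mem_singleton]
      by_contra h4
      exact h2 s (by omega) (by omega) hs3.2
    have := Finset.card_le_card this
    simp at this
    omega
  · rintro l ⟨h1, hl, -, h2⟩
    by_contra hcon
    have hper : c (l + N + 1) = c (l + 1) := by rw [← H.cyc.periodic (l + 1)]; congr 1; ring
    -- `l + N` is the largest element of `W`. If it lay in `U'`, every element of the nonempty `U`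
    -- would equal it.
    have hgap' : ∀ s ∈ W, s ≤ l + N := by
      intro s hs
      rw [hW, mem_attachments] at hs
      by_contra! h3
      refine h2 (s - N) (by omega) (by omega) ?_
      rw [H.cyc.sub_periodic]; exact hs.2
    have hlW : l + N ∈ W := by
      refine mem_attachments.2 ⟨⟨?_, by omega⟩, by rwa [H.cyc.periodic]⟩
      have hαW := (Finset.mem_filter.1 hα).1
      have := hgap' α hαW
      have := mem_attachments.1 hαW
      omega
    have hlU : l + N ∉ U := fun h' => hcon (by
      have := (Finset.mem_filter.1 h').2
      rwa [hper] at this)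
    have hlU' : l + N ∈ U' := by
      rw [← hWeq, Finset.mem_union] at hlW
      exact hlW.resolve_left hlU
    have h3 := hle _ hlU' α hα
    have h4 := hgap' α (Finset.mem_filter.1 hα).1
    exact hlU (by rwa [show l + N = α by omega])

end Attached

end SimpleGraph

/-! ### Heavy segments do not exist -/

namespace SimpleGraph

variable {V : Type*} {G : SimpleGraph V} {N : ℕ} {c : ℤ → V} {h : V} {k d : ℕ}

/-- The segment of `c` between the consecutive neighbours `c a` and `c b` of `h` ends in a vertex
with a neighbour among the successors. -/
def HeavySegment (G : SimpleGraph V) (N : ℕ) (c : ℤ → V) (h : V) (a b : ℤ) : Prop :=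
  Consecutive G c h a b ∧ ∃ v ∈ successors G N c h, G.Adj (c (b - 1)) v

lemma Consecutive.reverse {a b : ℤ} (hab : Consecutive G c h a b) :
    Consecutive G (fun t => c (-t)) h (-b) (-a) := by
  obtain ⟨h1, h2, h3, h4⟩ := hab
  exact ⟨by omega, by simpa using h3, by simpa using h2, fun s hs hs' => h4 _ (by omega) (by omega)⟩

namespace Attached

lemma lt_of_consecutive (H : Attached G N c h k d) {a b : ℤ} (hab : Consecutive G c h a b) :
    a + 1 < b := by
  obtain ⟨h1, h2, h3, -⟩ := hab
  rcases (show a + 1 ≤ b by omega).eq_or_lt with rfl | h4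
  · exact absurd h3 (H.not_adj_succ h2)
  · exact h4

lemma le_of_consecutive (H : Attached G N c h k d) {a b : ℤ} (hab : Consecutive G c h a b) :
    b ≤ a + N := by
  by_contra! h'
  have := H.cyc.three_le
  exact hab.2.2.2 (a + N) (by omega) h' (by rw [H.cyc.periodic]; exact hab.2.1)

lemma exists_consecutive_left (H : Attached G N c h k d) {b : ℤ} (hb : G.Adj h (c b)) :
    ∃ a, Consecutive G c h a b := by
  obtain ⟨a, h1, -, h2, h3⟩ := H.exists_prev b
  exact ⟨a, h1, h2, hb, h3⟩

lemma adj_of_heavySegment (H : Attached G N c h k d) {a b : ℤ} (hab : HeavySegment G N c h a b) :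
    G.Adj (c (b - 1)) (c (a + 1)) ∧
      (∀ w, Consecutive G c h b w → G.Adj (c b) (c (w + 1))) ∧
      ∀ l, Consecutive G c h l a → G.Adj (c (b - 1)) (c (l + 1)) := by
  have h1 := H.lt_of_consecutive hab.1
  have h2 := H.le_of_consecutive hab.1
  have := H.structure_of_adj_adj (a := a) (t := b - 1) (by omega) (by omega) hab.1.2.1
    (fun s hs hs' => hab.1.2.2.2 s hs (by omega)) hab.2
    ⟨h, self_mem_successors, by rw [sub_add_cancel]; exact hab.1.2.2.1.symm⟩
  rw [sub_add_cancel] at this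
  exact this.2

/-- Reversal exchanges successors and predecessors of the neighbours of `h`, and the reversed
segment ends in `c (a + 1)`. -/
lemma heavySegment_reverse_of_adj (H : Attached G N c h k d) {a b s : ℤ}
    (hab : Consecutive G c h a b) (hs : G.Adj h (c s)) (h' : G.Adj (c (a + 1)) (c (s - 1))) :
    HeavySegment G N (fun t => c (-t)) h (-b) (-a) := by
  refine ⟨hab.reverse, _, H.reverse.succ_mem (t := -s) (by simpa using hs), ?_⟩
  have e1 : -(-a - 1) = a + 1 := by ring
  have e2 : -(-s + 1) = s - 1 := by ring
  simpa only [e1, e2] using h'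

lemma heavySegment_reverse (H : Attached G N c h k d) {a b : ℤ}
    (hab : HeavySegment G N c h a b) : HeavySegment G N (fun t => c (-t)) h (-b) (-a) :=
  H.heavySegment_reverse_of_adj hab.1 hab.1.2.2.1 (H.adj_of_heavySegment hab).1.symm

/-- The forced chord from `c (b - 1)` to `c (l + 1)` makes the segment heavy in the reversed cycle;
reversing again makes it heavy in the original one. -/
lemma heavySegment_left (H : Attached G N c h k d) {l a b : ℤ}
    (hab : HeavySegment G N c h a b) (hla : Consecutive G c h l a) :
    HeavySegment G N c h l a := by
  have h1 := H.heavySegment_reverse_of_adj hla hab.1.2.2.1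
    ((H.adj_of_heavySegment hab).2.2 l hla).symm
  simpa using H.reverse.heavySegment_reverse h1

lemma adj_of_heavySegment_left (H : Attached G N c h k d) {l a b : ℤ}
    (hab : HeavySegment G N c h a b) (hla : Consecutive G c h l a) :
    G.Adj (c a) (c (l - 1)) := by
  have := (H.reverse.adj_of_heavySegment (H.heavySegment_reverse hab)).2.1 (-l) hla.reverse
  rw [neg_neg, show -(-l + 1) = l - 1 by ring] at this
  exact this

/-- Heaviness spreads to the three preceding segments. Their forced chords link the pieces of the
cycle in the order `p₁`, `(p₂, p₃)`, `(p₁, p₂)`, `[p₃, p₁ + N)`, `p₂`, and `h` closes this up. -/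
lemma not_heavySegment (H : Attached G N c h k d) {p₃ p₄ : ℤ} :
    ¬ HeavySegment G N c h p₃ p₄ := by
  classical
  intro h34
  obtain ⟨p₂, c23⟩ := H.exists_consecutive_left h34.1.2.1
  obtain ⟨p₁, c12⟩ := H.exists_consecutive_left c23.2.1
  obtain ⟨p₀, c01⟩ := H.exists_consecutive_left c12.2.1
  have h23 := H.heavySegment_left h34 c23
  have h12 := H.heavySegment_left h23 c12
  have h01 := H.heavySegment_left h12 c01
  have e1 : G.Adj (c p₁) (c (p₂ + 1)) := (H.adj_of_heavySegment h01).2.1 _ c12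
  have e2 : G.Adj (c (p₃ - 1)) (c (p₁ + 1)) := (H.adj_of_heavySegment h23).2.2 _ c12
  have e3 : G.Adj (c p₃) (c (p₂ - 1)) := H.adj_of_heavySegment_left h34 c23
  have e4 : G.Adj (c p₂) (c (p₁ - 1)) := H.adj_of_heavySegment_left h23 c12
  have l12 := H.lt_of_consecutive c12
  have l23 := H.lt_of_consecutive c23
  -- Otherwise `h` would have at most two neighbours on the cycle, whereas `d ≥ 4`.
  have l3 : p₃ < p₁ + N := by
    by_contra! h'
    have hsub : attachments G c h p₁ (p₁ + N) ⊆ {p₁, p₂} := by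
      intro s hs
      rw [mem_attachments] at hs
      rw [Finset.mem_insert, Finset.mem_singleton]
      rcases lt_trichotomy s p₂ with h5 | h5 | h5
      · left
        by_contra h6
        exact c12.2.2.2 s (by omega) h5 hs.2
      · exact .inr h5
      · exact absurd hs.2 (c23.2.2.2 s h5 (by omega))
    have := (Finset.card_le_card hsub).trans Finset.card_le_two
    rw [H.count] at this
    have := H.deg; have := H.three_le
    omega
  refine H.cyc.not_closable_of_earJoined (H.earJoined c23.2.1 c12.2.1) (w := p₁)
    (L := [p₁] ++ (intSeg (p₂ + 1) (p₃ - 1) ++ (intSeg (p₁ + 1) (p₂ - 1) ++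
      (intSeg p₃ (p₁ + N - 1) ++ [p₂])))) ?_ ?_ (by simp; omega) ?_ (by simp) (.inl ?_)
  · simp only [List.nodup_append, List.nodup_singleton, intSeg_nodup, List.mem_singleton,
      mem_intSeg, true_and, List.mem_append]
    refine ⟨⟨⟨?_, ?_⟩, ?_⟩, ?_⟩ <;> intro x hx y hy <;> omega
  · simp only [List.mem_append, List.mem_singleton, mem_intSeg]; omega
  · refine (List.isChain_singleton _).append ((isChain_intSeg H.cyc.adj _ _).append
      ((isChain_intSeg H.cyc.adj _ _).append ((isChain_intSeg H.cyc.adj _ _).append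
        (List.isChain_singleton _) ?_) ?_) ?_) ?_
    · rw [getLast?_intSeg (by omega)]
      have : c (p₁ + N - 1) = c (p₁ - 1) := by
        rw [← H.cyc.periodic (p₁ - 1)]; congr 1; ring
      simpa [this] using e4.symm
    · rw [getLast?_intSeg (by omega), List.head?_append, head?_intSeg (by omega)]
      simpa using e3.symm
    · rw [getLast?_intSeg (by omega), List.head?_append, head?_intSeg (by omega)]
      simpa using e2
    · rw [List.head?_append, head?_intSeg (by omega)]
      simpa using e1
  · simp only [List.getLast?_append, List.getLast?_singleton, Option.some_or]

lemma not_adj_and_adj (H : Attached G N c h k d) (t : ℤ)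
    (h0 : ∃ v ∈ successors G N c h, G.Adj (c t) v)
    (h1 : ∃ v ∈ successors G N c h, G.Adj (c (t + 1)) v) : False := by
  obtain ⟨a, hat, hta, ha, hgap⟩ := H.exists_prev t
  have := H.structure_of_adj_adj hat hta ha hgap h0 h1
  exact H.not_heavySegment ⟨this.1, by rwa [add_sub_cancel_right]⟩

end Attached

/-! ### The contradiction with toughness -/

lemma card_le_numComponentsDelete [Fintype V] {S I : Finset V} (hSI : Disjoint I S)
    (hadj : ∀ v, v ∉ S → ∀ w, w ∉ S → ¬ G.Adj v w) : I.card ≤ G.numComponentsDelete S := by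
  have hm : ∀ i : I, (i : V) ∈ ((S : Set V)ᶜ : Set V) := fun i =>
    Finset.disjoint_left.1 hSI i.2
  rw [numComponentsDelete, ← Fintype.card_coe, ← Nat.card_eq_fintype_card]
  refine Nat.card_le_card_of_injective
    (fun i : I => (G.induce ((S : Set V)ᶜ)).connectedComponentMk ⟨i, hm i⟩) ?_
  intro i j hij
  obtain ⟨w⟩ := ConnectedComponent.exact hij
  have key : ∀ (a b : ((S : Set V)ᶜ : Set V)), (G.induce ((S : Set V)ᶜ)).Walk a b → a = b := by
    rintro a b w
    cases w with
    | nil => rfl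
    | @cons _ x _ hab _ => exact absurd (comap_adj.1 hab) (hadj _ a.2 _ x.2)
  exact Subtype.ext (congrArg Subtype.val (key _ _ w) :)

namespace Attached

open Classical in
lemma card_filter_le_one (H : Attached G N c h k d) {r : V} (roff : ∀ t, c t ≠ r) (hr : h ≠ r)
    (hhr : ¬ G.Adj r h) : ((successors G N c h).filter (G.Adj r)).card ≤ 1 := by
  rw [Finset.card_le_one]
  intro x hx y hy
  rw [Finset.mem_filter, H.mem_successors] at hx hy
  obtain ⟨rfl | ⟨s, hs, rfl⟩, hx⟩ := hx
  · exact absurd hx hhr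
  obtain ⟨rfl | ⟨t, ht, rfl⟩, hy⟩ := hy
  · exact absurd hy hhr
  obtain ⟨u, e0, e1, e2, e3, -⟩ := H.cyc.exists_window s t
  rw [← e3] at hy ⊢
  rw [← e2] at ht
  rcases e0.eq_or_lt with rfl | e0
  · rfl
  · exact (H.cyc.not_adj_two_succ H.off roff hr hs ht e0 e1 hx hy).elim

theorem not_isTough [Fintype V] (H : Attached G N c h k d)
    (hoff : ∀ u v, (∀ t, c t ≠ u) → (∀ t, c t ≠ v) → ¬ G.Adj u v) : ¬ G.IsTough 1 := by
  classical
  intro htough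
  have hN := H.cyc.three_le
  let heavy : V → Prop := fun u => ∃ v ∈ successors G N c h, G.Adj u v
  have hh : ¬ heavy h := by
    rintro ⟨v, hv, h'⟩
    exact H.independent self_mem_successors hv h'
  have hlight : ∀ u v, ¬ heavy u → ¬ heavy v → ¬ G.Adj u v := by
    intro u v hu hv huv
    obtain ⟨a, ha, h' | h'⟩ := H.exists_adj_of_adj huv
    exacts [hu ⟨a, ha, h'⟩, hv ⟨a, ha, h'⟩]
  -- A heavy vertex sees at least `d + 2 - k ≥ 3` members of the set, a vertex off the cycle at most
  -- one.
  have hrlight : ∀ r, (∀ t, c t ≠ r) → ¬ heavy r := by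
    rintro r hr ⟨v, hv, hrv⟩
    by_cases hhr : h = r
    · subst hhr; exact hh ⟨v, hv, hrv⟩
    have h1 := H.le_card_filter hv hrv
    have h2 := H.card_filter_le_one hr hhr (hoff _ _ hr H.off)
    have := H.deg; have := H.three_le
    omega
  let T := (Finset.Ico (0 : ℤ) N).filter fun t => heavy (c t)
  have hT : ∀ t ∈ T, (0 ≤ t ∧ t < N) ∧ heavy (c t) := fun t ht => by simpa [T] using ht
  let S := T.image c
  let I := insert h (T.image fun t => c (t + 1))
  have hS : ∀ v, v ∉ S → ¬ heavy v := by
    intro v hv hvh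
    by_cases hvc : ∃ t, c t = v
    · obtain ⟨t, rfl⟩ := hvc
      obtain ⟨u, e0, e1, e2, -, -⟩ := H.cyc.exists_window 0 t
      refine hv (Finset.mem_image.2 ⟨u, ?_, e2⟩)
      simp only [T, Finset.mem_filter, Finset.mem_Ico]
      exact ⟨by omega, by rwa [e2]⟩
    · exact hrlight v (by simpa using hvc) hvh
  have hcardS : S.card ≤ T.card := Finset.card_image_le
  have hcardI : I.card = T.card + 1 := by
    rw [Finset.card_insert_of_notMem, Finset.card_image_of_injOn]
    · intro x hx y hy e
      have := hT x hx; have := hT y hy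
      rcases le_total x y with h' | h'
      · have := H.cyc.inj _ _ (by omega) (by omega) e; omega
      · have := H.cyc.inj _ _ (by omega) (by omega) e.symm; omega
    · simp only [Finset.mem_image, not_exists, not_and]
      exact fun t _ => H.off _
  have hSh : ∀ v ∈ S, heavy v := by
    intro v hv
    obtain ⟨t, ht, rfl⟩ := Finset.mem_image.1 hv
    exact (hT t ht).2
  have hdisj : Disjoint I S := by
    rw [Finset.disjoint_left]
    intro v hv hvS
    have hvh := hSh v hvS
    obtain rfl | hv := Finset.mem_insert.1 hv
    · exact hh hvh
    · obtain ⟨t, ht, rfl⟩ := Finset.mem_image.1 hv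
      exact H.not_adj_and_adj t (hT t ht).2 hvh
  have hle := card_le_numComponentsDelete (G := G) hdisj fun v hv w hw =>
    hlight v w (hS v hv) (hS w hw)
  -- Toughness only applies to at least two components. The neighbours of `h` are heavy, so `I` has
  -- at least two elements.
  have hTpos : 0 < T.card := by
    obtain ⟨a, -, -, ha, -⟩ := H.exists_prev 0
    obtain ⟨u, e0, e1, e2, -, -⟩ := H.cyc.exists_window 0 a
    refine Finset.card_pos.2 ⟨u, ?_⟩
    simp only [T, Finset.mem_filter, Finset.mem_Ico]
    exact ⟨by omega, h, self_mem_successors, by rw [e2]; exact ha.symm⟩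
  have := htough S (by omega)
  rw [one_mul] at this
  have : G.numComponentsDelete S ≤ S.card := by exact_mod_cast this
  omega

end Attached

end SimpleGraph

/-! ### Vertices off a longest cycle, and the conclusion -/

namespace SimpleGraph

variable {V : Type*} {G : SimpleGraph V} {N : ℕ} {c : ℤ → V} {h : V} {k : ℕ}

lemma IsLongestCycle.exists_not_mem (hc : IsLongestCycle G N c) {S : Finset V}
    (hS : ∀ a b, c a ∈ S → c b ∈ S → EarJoined G c a b) : ∃ x, c x ∉ S := by
  by_contra! hcon
  exact hc.not_earJoined_succ 0 (hS _ _ (hcon _) (hcon _))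

lemma IsLongestCycle.card_image_le (hc : IsLongestCycle G N c) [DecidableEq V] (T : Finset ℤ)
    (hT : ∀ t ∈ T, 0 ≤ t ∧ t < N) : (T.image c).card ≤ (T.image fun t => c (t + 1)).card := by
  rw [Finset.card_image_of_injOn (f := fun t => c (t + 1))]
  · exact Finset.card_image_le
  · intro x hx y hy e
    have := hT x hx; have := hT y hy
    rcases le_total x y with h' | h'
    · have := hc.inj _ _ (by omega) (by omega) e; omega
    · have := hc.inj _ _ (by omega) (by omega) e.symm; omega

lemma IsLongestCycle.not_adj_of_off [Fintype V] (hc : IsLongestCycle G N c) (hk : 3 ≤ k)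
    (hconn : G.IsKConnected (2 * k - 2)) (hfree : G.IsInducedFree (pathTwoUnionIsolated k))
    {h r : V} (hoff : ∀ t, c t ≠ h) (roff : ∀ t, c t ≠ r) : ¬ G.Adj h r := by
  classical
  intro hhr
  have hh : h ∈ ((Set.range c)ᶜ : Set V) := by simpa using hoff
  have hr : r ∈ ((Set.range c)ᶜ : Set V) := by simpa using roff
  let D : Set V := {v | ∃ hv : v ∈ ((Set.range c)ᶜ : Set V),
    (G.induce (Set.range c)ᶜ).Reachable ⟨h, hh⟩ ⟨v, hv⟩}
  have hhD : h ∈ D := ⟨hh, .rfl⟩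
  have hDcl : ∀ v ∈ D, ∀ w, w ∈ ((Set.range c)ᶜ : Set V) → G.Adj v w → w ∈ D := by
    rintro v ⟨hv, hvr⟩ w hw hvw
    exact ⟨hw, hvr.trans (Adj.reachable (comap_adj.2 hvw))⟩
  have hrD : r ∈ D := hDcl h hhD r hr hhr
  let S : Finset V := Finset.univ.filter fun w => (∃ t, c t = w) ∧ ∃ v ∈ D, G.Adj v w
  have hS : ∀ w, w ∈ S ↔ (∃ t, c t = w) ∧ ∃ v ∈ D, G.Adj v w := fun w => by simp [S]
  have hear : ∀ a b, c a ∈ S → c b ∈ S → EarJoined G c a b := by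
    intro a b ha hb
    obtain ⟨-, p, ⟨hp, hpr⟩, hpa⟩ := (hS _).1 ha
    obtain ⟨-, q, ⟨hq, hqr⟩, hqb⟩ := (hS _).1 hb
    exact .of_reachable (hpr.symm.trans hqr) hpa hqb
  -- Some cycle vertex is not an attachment of `D`, so the attachments separate it from `D` and
  -- connectivity bounds their number from below.
  obtain ⟨x, hx⟩ := hc.exists_not_mem hear
  have hm := hconn.le_card (H := D) (S := S) (h := h) (x := c x) hhD
    (fun h' => by obtain ⟨⟨t, ht⟩, -⟩ := (hS _).1 h'; exact hoff t ht)
    (fun h' => h'.1 ⟨x, rfl⟩) hx fun v hv w hvw => by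
      by_cases hw : w ∈ Set.range c
      · exact .inr ((hS _).2 ⟨hw, v, hv, hvw⟩)
      · exact .inl (hDcl v hv w hw hvw)
  let T := (Finset.Ico (0 : ℤ) N).filter fun t => c t ∈ S
  have hT : ∀ t ∈ T, (0 ≤ t ∧ t < N) ∧ c t ∈ S := fun t ht => by simpa [T] using ht
  have hST : S ⊆ T.image c := by
    intro w hw
    obtain ⟨⟨t, rfl⟩, -⟩ := (hS _).1 hw
    obtain ⟨u, e0, e1, e2, -, -⟩ := hc.exists_window 0 t
    refine Finset.mem_image.2 ⟨u, ?_, e2⟩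
    simp only [T, Finset.mem_filter, Finset.mem_Ico]
    exact ⟨by omega, by rwa [e2]⟩
  have h1 := Finset.card_le_card hST
  have h2 := hc.card_image_le T fun t ht => (hT t ht).1
  have hD : ∀ v ∈ D, ∀ t ∈ T, ¬ G.Adj v (c (t + 1)) := fun v hv t ht h' =>
    hc.not_earJoined_succ t (hear _ _ (hT t ht).2 ((hS _).2 ⟨⟨_, rfl⟩, v, hv, h'⟩))
  -- The successors of the attachments number at least `2 * k - 2 ≥ k`, too many to be independent
  -- and to miss the edge `h r`.
  have h3 := hfree.card_lt hhr (T := T.image fun t => c (t + 1)) ?_ ?_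
  · omega
  · intro a ha
    obtain ⟨t, ht, rfl⟩ := Finset.mem_image.1 ha
    exact ⟨hoff _, roff _, hD h hhD t ht, hD r hrD t ht⟩
  · intro a ha b hb
    obtain ⟨s, hs, rfl⟩ := Finset.mem_image.1 ha
    obtain ⟨t, ht, rfl⟩ := Finset.mem_image.1 hb
    have hs' := hT s hs
    have ht' := hT t ht
    rcases lt_trichotomy s t with h' | rfl | h'
    · exact hc.not_adj_succ (hear _ _ hs'.2 ht'.2) h' (by omega)
    · exact G.irrefl
    · exact fun h4 => hc.not_adj_succ (hear _ _ ht'.2 hs'.2) h' (by omega) h4.symm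

lemma IsLongestCycle.exists_attached [Fintype V] (hc : IsLongestCycle G N c) (hk : 3 ≤ k)
    (hconn : G.IsKConnected (2 * k - 2)) (hfree : G.IsInducedFree (pathTwoUnionIsolated k))
    (hoff : ∀ t, c t ≠ h) : ∃ d, Attached G N c h k d := by
  classical
  have hnbr : ∀ v, G.Adj h v → ∃ t, c t = v := by
    intro v hv
    by_contra! hcon
    exact hc.not_adj_of_off hk hconn hfree hoff hcon hv
  let S : Finset V := Finset.univ.filter (G.Adj h)
  have hS : ∀ w, w ∈ S ↔ G.Adj h w := fun w => by simp [S]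
  obtain ⟨x, hx⟩ := hc.exists_not_mem (S := S) fun a b ha hb =>
    .of_adj hoff ((hS _).1 ha) ((hS _).1 hb)
  have hm := hconn.le_card (H := {h}) (S := S) (h := h) (x := c x) rfl (by simp [hS])
    (hoff x) hx (by rintro _ rfl w hw; exact .inr ((hS _).2 hw))
  refine ⟨S.card, hc, hoff, hk, by omega, fun s => ?_, fun u v huv T h1 h2 =>
    hfree.card_lt huv h1 h2⟩
  refine Finset.card_bij (fun t _ => c t) ?_ ?_ ?_
  · intro t ht
    exact (hS _).2 (mem_attachments.1 ht).2
  · intro a ha b hb e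
    rw [mem_attachments] at ha hb
    rcases le_total a b with h' | h'
    · exact hc.inj _ _ h' (by omega) e
    · exact (hc.inj _ _ h' (by omega) e.symm).symm
  · intro v hv
    rw [hS] at hv
    obtain ⟨t, rfl⟩ := hnbr v hv
    obtain ⟨u, e0, e1, e2, -, -⟩ := hc.exists_window s t
    exact ⟨u, mem_attachments.2 ⟨⟨e0, e1⟩, by rwa [e2]⟩, e2⟩

lemma IsLongestCycle.isHamiltonian [Fintype V] [DecidableEq V] (hc : IsLongestCycle G N c)
    (hall : ∀ v, ∃ t, c t = v) : G.IsHamiltonian := by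
  have hN := hc.three_le
  have hwalk : ∀ n : ℕ, ∃ p : G.Walk (c 0) (c n),
      p.support = (List.range (n + 1)).map fun i : ℕ => c i := by
    intro n
    induction n with
    | zero => exact ⟨.nil, by simp⟩
    | succ n ih =>
      obtain ⟨p, hp⟩ := ih
      have hadj : G.Adj (c n) (c (n + 1 : ℕ)) := by exact_mod_cast hc.adj n
      refine ⟨p.concat hadj, ?_⟩
      rw [Walk.support_concat, hp, List.range_succ (n := n + 1), List.map_append]
      simp
  obtain ⟨p, hp⟩ := hwalk (N - 1)
  rw [Nat.sub_add_cancel (by omega)] at hp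
  have hclose : G.Adj (c ((N - 1 : ℕ) : ℤ)) (c 0) := by
    have := hc.adj ((N - 1 : ℕ) : ℤ)
    rwa [show ((N - 1 : ℕ) : ℤ) + 1 = 0 + N by omega, hc.periodic] at this
  have hnodup : p.support.Nodup := by
    rw [hp]
    refine List.Nodup.map_on ?_ List.nodup_range
    intro x hx y hy e
    rw [List.mem_range] at hx hy
    rcases le_total x y with h' | h'
    · have := hc.inj _ _ (by omega) (by omega) e; omega
    · have := hc.inj _ _ (by omega) (by omega) e.symm; omega
  have hpath : p.IsPath := .mk' hnodup
  have hlen : p.length + 1 = N := by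
    rw [← Walk.length_support, hp]; simp
  -- `IsHamiltonian` asks for a cycle only if the number of vertices is not one.
  intro _
  refine ⟨_, .cons hclose p, Walk.isHamiltonianCycle_iff_isCycle_and_support_count_tail_eq_one.2
    ⟨(Walk.cons_isCycle_iff p hclose).2 ⟨hpath, fun he => ?_⟩, fun v => ?_⟩⟩
  -- A path containing the edge between its own ends has length one, but `N ≥ 3`.
  · rw [Sym2.eq_swap] at he
    have := hpath.length_eq_one_of_mem_edges he
    omega
  · rw [Walk.support_cons, List.tail_cons]
    refine List.count_eq_one_of_mem hnodup ?_
    obtain ⟨t, rfl⟩ := hall v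
    obtain ⟨u, e0, e1, e2, -, -⟩ := hc.exists_window 0 t
    rw [hp, List.mem_map]
    exact ⟨u.toNat, by rw [List.mem_range]; omega, by rw [Int.toNat_of_nonneg e0, e2]⟩

end SimpleGraph

theorem mainTheorem2 {V : Type*} [Fintype V] [DecidableEq V] (G : SimpleGraph V)
    (k : ℕ) (hk : 3 ≤ k)
    (htough : G.IsTough 1)
    (hconn : G.IsKConnected (2 * k - 2))
    (hfree : G.IsInducedFree (SimpleGraph.pathTwoUnionIsolated k)) :
    G.IsHamiltonian := by
  obtain ⟨l, hl⟩ := hconn.exists_isCyclicList (by omega)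
  obtain ⟨N, c, hc⟩ := SimpleGraph.exists_isLongestCycle hl
  by_cases hall : ∀ v, ∃ t, c t = v
  · exact hc.isHamiltonian hall
  · push Not at hall
    obtain ⟨h, hoff⟩ := hall
    obtain ⟨d, H⟩ := hc.exists_attached hk hconn hfree hoff
    exact absurd htough (H.not_isTough fun u v hu hv => hc.not_adj_of_off hk hconn hfree hu hv)
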